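/- A \emph{polygon} is a two-dimensional convex lattice polygon in $\mathbb{R}^2$, i.e. a convex hull of finitely many points of $\mathbb{Z}^2$ that has dimension two. Two polygons $P,P'$ are \emph{equivalent} if $P'=t(P)$ for some map $t(x)=Ax+b$ with $A$ an integer $2\times 2$ matrix of determinant $\pm1$ and $b\in\mathbb{Z}^2$. The \emph{lattice diameter} of $P$ is the largest $d$ such that $P\cap\mathbb{Z}^2$ contains $d+1$ collinear points. Lattice points $p,q$ are \emph{visible} to one another if the segment $\overline{pq}$ contains no lattice points other than $p$ and $q$. A polygon $P$ is a \emph{panoptigon} if there is a point $p\in P\cap\mathbb{Z}^2$ from which every point of $P\cap\mathbb{Z}^2$ is visible. A polygon $P$ is a \emph{diploptigon} if it is not a panoptigon, but there are $p,q\in P\cap\mathbb{Z}^2$ such that every point of $P\cap\mathbb{Z}^2$ other than $q$ is visible to $p$, every point of $P\cap\mathbb{Z}^2$ other than $p$ is visible to $q$, and no two of these lines of sight (the segments from $p$ to the lattice points of $P$ other than $p,q$ and the segments from $q$ to the lattice points of $P$ other than $p,q$) cross, that is, no two distinct ones meet in a point that is not a common endpoint. \textbf{Proposition.} Up to equivalence,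 there is exactly one diploptigon of lattice diameter at most $2$, namely the triangle with vertices $(1,0)$, $(3,1)$ and $(0,3)$. That is, this triangle is a diploptigon of lattice diameter at most $2$, and every diploptigon of lattice diameter at most $2$ is equivalent to it. -/

import Mathlib

/-- The point of the real plane given by an integer vector. -/
def toPlane (p : Fin 2 → ℤ) : Fin 2 → ℝ := fun i => (p i : ℝ)

/-- The lattice points `P ∩ ℤ²` of a subset of the plane, as integer vectors. -/
def latticePoints (P : Set (Fin 2 → ℝ)) : Set (Fin 2 → ℤ) := {p | toPlane p ∈ P}

/-- A polygon: a two-dimensional convex lattice polygon, that is, the convex hull of finitely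
many lattice points that affinely spans the plane. -/
def IsPolygon (P : Set (Fin 2 → ℝ)) : Prop :=
  (∃ V : Finset (Fin 2 → ℤ), P = convexHull ℝ (toPlane '' (V : Set (Fin 2 → ℤ)))) ∧
    affineSpan ℝ P = ⊤

/-- `t` is a unimodular transformation `x ↦ A x + b` of the plane, with `A` an integer matrix of
determinant `±1` and `b` a lattice vector. -/
def IsUnimodularTransformation (t : (Fin 2 → ℝ) → (Fin 2 → ℝ)) : Prop :=
  ∃ (A : Matrix (Fin 2) (Fin 2) ℤ) (b : Fin 2 → ℤ), (A.det = 1 ∨ A.det = -1) ∧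
    ∀ x, t x = Matrix.mulVec (A.map (fun a : ℤ => (a : ℝ))) x + toPlane b

/-- `P'` is equivalent to `P`: some unimodular transformation carries `P` onto `P'`. -/
def UnimodularEquivalent (P' P : Set (Fin 2 → ℝ)) : Prop :=
  ∃ t, IsUnimodularTransformation t ∧ t '' P = P'

/-- Two lattice points are visible to one another if the segment joining them contains no lattice
points besides the two of them. -/
def Visible (p q : Fin 2 → ℤ) : Prop :=
  ∀ r : Fin 2 → ℤ, toPlane r ∈ segment ℝ (toPlane p) (toPlane q) → r = p ∨ r = q

/-- A polygon all of whose lattice points are visible from one of them. -/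
def IsPanoptigon (P : Set (Fin 2 → ℝ)) : Prop :=
  IsPolygon P ∧ ∃ p ∈ latticePoints P, ∀ q ∈ latticePoints P, Visible p q

/-- The conditions on a pair of diploptigon points `p`, `q`: all lattice points of `P` besides `q`
are visible to `p`, all besides `p` are visible to `q`, and no two lines of sight cross.
Two distinct lines of sight from the same point meet only in that point, by visibility, so the
last condition only has to be asked of a line of sight from `p` and one from `q`; by visibility
again, two of these meet outside their common endpoints only if their relative interiors meet. -/
def IsDiploptigonPair (P : Set (Fin 2 → ℝ)) (p q : Fin 2 → ℤ) : Prop :=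
  p ∈ latticePoints P ∧ q ∈ latticePoints P ∧ p ≠ q ∧
    (∀ r ∈ latticePoints P, r ≠ q → Visible p r) ∧
    (∀ r ∈ latticePoints P, r ≠ p → Visible q r) ∧
    ∀ r ∈ latticePoints P, ∀ s ∈ latticePoints P, r ≠ p → r ≠ q → s ≠ p → s ≠ q →
      Disjoint (openSegment ℝ (toPlane p) (toPlane r)) (openSegment ℝ (toPlane q) (toPlane s))

/-- A polygon that is not a panoptigon but has a pair of diploptigon points. -/
def IsDiploptigon (P : Set (Fin 2 → ℝ)) : Prop :=
  IsPolygon P ∧ ¬ IsPanoptigon P ∧ ∃ p q, IsDiploptigonPair P p q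

/-- The lattice diameter: the largest `d` such that `P` contains `d + 1` collinear lattice points.
The supremum is taken in `ℕ∞`, so that it is meaningful without a boundedness proof. -/
noncomputable def latticeDiameter (P : Set (Fin 2 → ℝ)) : ℕ∞ :=
  sSup {D : ℕ∞ | ∃ (d : ℕ) (S : Finset (Fin 2 → ℤ)), D = (d : ℕ∞) ∧ S.card = d + 1 ∧
    (S : Set (Fin 2 → ℤ)) ⊆ latticePoints P ∧
    Collinear ℝ (toPlane '' (S : Set (Fin 2 → ℤ)))}

/-- The triangle with vertices `(1,0)`, `(3,1)` and `(0,3)`. -/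
def diploTriangle : Set (Fin 2 → ℝ) := convexHull ℝ {![1, 0], ![3, 1], ![0, 3]}

/-! Since P is not a panoptigon, p does not see some lattice point of P, and this must be q; so q =
p + k • d with k ≥ 2. Lattice diameter at most 2 forces k = 2 and d primitive, and a change of
lattice coordinates puts p, q at (-1,0), (1,0) (`isNormal`).

In this position the row y = 1 holds at most one lattice point of P, since two would give crossing
lines of sight (`row_one_le`). Convexity then makes the upper half small: if (a,1) is present, the
only other possible point there is (2a,2) (`upper_points`), and likewise below the axis. The rest
comes from the fact that every lattice point has a hidden one. For the origin this forces a point at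
height 2 or -2; after a flip and a shear, (0,1) and (0,2) are present. For (0,1) it forces a point
(b,-1), and up to reflection only b = 2 survives (`eq_normalPoints`).

`LatticeConfiguration` states all this over the integers: `hidden` and `pair` encode invisibility as
a difference divisible by some k ≥ 2, and `cross` clears a common denominator n from the meeting
point of two open segments. A polygon is the hull of its lattice points, so the integral
classification gives the real one. -/

/-- The integral data of a diploptigon of lattice diameter at most two: its set `S` of lattice
points and the two points `p`, `q`. -/
structure LatticeConfiguration (S : Set (Fin 2 → ℤ)) (p q : Fin 2 → ℤ) : Prop where
  convex : ∀ a ∈ S, ∀ b ∈ S, ∀ c ∈ S, ∀ i j k : ℤ, 0 ≤ i → 0 ≤ j → 0 ≤ k → 0 < i + j + k →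
    ∀ x, (i + j + k) • x = i • a + j • b + k • c → x ∈ S
  left_mem : p ∈ S
  right_mem : q ∈ S
  diam : ∀ a v, a ∈ S → a + v ∈ S → a + (2 : ℤ) • v ∈ S → a + (3 : ℤ) • v ∈ S → v = 0
  cross : ∀ r ∈ S, ∀ s ∈ S, r ≠ p → r ≠ q → s ≠ p → s ≠ q → ∀ i j n : ℤ,
    0 < i → i < n → 0 < j → j < n → (n - i) • p + i • r ≠ (n - j) • q + j • s
  hidden : ∀ a ∈ S, ∃ (k : ℤ) (d : Fin 2 → ℤ), 2 ≤ k ∧ d ≠ 0 ∧ a + k • d ∈ S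
  pair : ∃ (k : ℤ) (d : Fin 2 → ℤ), 2 ≤ k ∧ d ≠ 0 ∧ q = p + k • d

namespace LatticeConfiguration

/-! ### Changes of lattice coordinates -/

/-- The invertible affine map of the lattice with linear part `e` and translation part `b`. -/
def affineMap (e : (Fin 2 → ℤ) ≃ₗ[ℤ] (Fin 2 → ℤ)) (b x : Fin 2 → ℤ) : Fin 2 → ℤ := b + e x

theorem preimage {S : Set (Fin 2 → ℤ)} {p q : Fin 2 → ℤ}
    (e : (Fin 2 → ℤ) ≃ₗ[ℤ] (Fin 2 → ℤ)) (b : Fin 2 → ℤ)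
    (h : LatticeConfiguration S (affineMap e b p) (affineMap e b q)) :
    LatticeConfiguration (affineMap e b ⁻¹' S) p q := by
  have inj : Function.Injective (affineMap e b) := fun x y hxy =>
    e.injective (add_left_cancel hxy)
  have step : ∀ a v : Fin 2 → ℤ, ∀ k : ℤ,
      affineMap e b (a + k • v) = affineMap e b a + k • e v := by
    intro a v k
    simp only [affineMap, map_add, map_smul, add_assoc]
  refine ⟨?_, h.left_mem, h.right_mem, ?_, ?_, ?_, ?_⟩
  · intro a ha c hc d hd i j k hi hj hk hn x hx
    refine h.convex _ ha _ hc _ hd i j k hi hj hk hn _ ?_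
    have := congrArg e hx
    simp only [map_smul, map_add] at this
    simp only [affineMap, smul_add, this]
    module
  · intro a v h0 h1 h2 h3
    have := h.diam (affineMap e b a) (e v) h0
      (by have := step a v 1; simp only [one_smul] at this; rw [← this]; exact h1)
      (by rw [← step]; exact h2) (by rw [← step]; exact h3)
    simpa using this
  · intro r hr s hs h1 h2 h3 h4 i j n hi hin hj hjn heq
    refine h.cross _ hr _ hs (inj.ne h1) (inj.ne h2) (inj.ne h3) (inj.ne h4) i j n hi hin hj hjn ?_
    have := congrArg e heq
    simp only [map_smul, map_add] at this
    calc (n - i) • affineMap e b p + i • affineMap e b r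
        = n • b + ((n - i) • e p + i • e r) := by simp only [affineMap]; module
      _ = n • b + ((n - j) • e q + j • e s) := by rw [this]
      _ = _ := by simp only [affineMap]; module
  · intro a ha
    obtain ⟨k, d, hk, hd, hm⟩ := h.hidden _ ha
    refine ⟨k, e.symm d, hk, by simpa using hd, ?_⟩
    rw [Set.mem_preimage, step]
    simpa using hm
  · obtain ⟨k, d, hk, hd, hm⟩ := h.pair
    refine ⟨k, e.symm d, hk, by simpa using hd, inj ?_⟩
    rw [step, hm]
    simp

/-- Bézout coefficients complete a primitive vector to a basis of ℤ². -/
theorem exists_affineMap_basis (v : Fin 2 → ℤ) (h : IsCoprime (v 0) (v 1)) :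
    ∃ e : (Fin 2 → ℤ) ≃ₗ[ℤ] (Fin 2 → ℤ), e ![1, 0] = v := by
  obtain ⟨a, c, hac⟩ := h
  refine ⟨Matrix.toLin'OfInv (M' := !![v 0, -c; v 1, a]) (M := !![a, c; -v 1, v 0]) ?_ ?_, ?_⟩
  · ext i j; fin_cases i <;> fin_cases j <;> simp <;> linarith
  · ext i j; fin_cases i <;> fin_cases j <;> simp <;> linarith
  · ext i; fin_cases i <;> simp [Matrix.toLin'OfInv]

/-- The shear fixing the first axis and moving `(0, 1)` to `(a, 1)`. -/
def shear (a : ℤ) : (Fin 2 → ℤ) ≃ₗ[ℤ] (Fin 2 → ℤ) :=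
  Matrix.toLin'OfInv (M' := !![1, a; 0, 1]) (M := !![1, -a; 0, 1])
    (by ext i j; fin_cases i <;> fin_cases j <;> simp)
    (by ext i j; fin_cases i <;> fin_cases j <;> simp)

/-- The reflection in the first axis. -/
def flipY : (Fin 2 → ℤ) ≃ₗ[ℤ] (Fin 2 → ℤ) :=
  Matrix.toLin'OfInv (M := !![1, 0; 0, -1]) (M' := !![1, 0; 0, -1])
    (by ext i j; fin_cases i <;> fin_cases j <;> simp)
    (by ext i j; fin_cases i <;> fin_cases j <;> simp)

theorem affineMap_shear (a x y : ℤ) : affineMap (shear a) 0 ![x, y] = ![x + a * y, y] := by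
  ext i; fin_cases i <;> simp [affineMap, shear, Matrix.toLin'OfInv, mul_comm]

theorem affineMap_flipY (x y : ℤ) : affineMap flipY 0 ![x, y] = ![x, -y] := by
  ext i; fin_cases i <;> simp [affineMap, flipY, Matrix.toLin'OfInv]

/-- The reflection in the second axis. -/
def flipX : (Fin 2 → ℤ) ≃ₗ[ℤ] (Fin 2 → ℤ) := flipY.trans (LinearEquiv.neg ℤ)

theorem affineMap_flipX (x y : ℤ) : affineMap flipX 0 ![x, y] = ![-x, y] := by
  ext i; fin_cases i <;> simp [affineMap, flipX, flipY, Matrix.toLin'OfInv]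

theorem swap {S : Set (Fin 2 → ℤ)} {p q : Fin 2 → ℤ} (h : LatticeConfiguration S p q) :
    LatticeConfiguration S q p where
  convex := h.convex
  left_mem := h.right_mem
  right_mem := h.left_mem
  diam := h.diam
  cross r hr s hs h1 h2 h3 h4 i j n hi hin hj hjn heq :=
    h.cross s hs r hr h4 h3 h2 h1 j i n hj hjn hi hin heq.symm
  hidden := h.hidden
  pair := by
    obtain ⟨k, d, hk, hd, rfl⟩ := h.pair
    exact ⟨k, -d, hk, neg_ne_zero.mpr hd, by simp⟩

/-- The lattice points of a normal form of the triangle. -/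
def normalPoints : Set (Fin 2 → ℤ) :=
  {![-1, 0], ![0, 0], ![1, 0], ![0, 1], ![0, 2], ![2, -1]}

theorem affineMap_refl : affineMap (LinearEquiv.refl ℤ _) 0 = id := by
  ext x; simp [affineMap]

/-- `S` is an affine unimodular image of `normalPoints`. -/
def IsNormal (S : Set (Fin 2 → ℤ)) : Prop := ∃ e b, S = affineMap e b '' normalPoints

theorem IsNormal.of_preimage {S : Set (Fin 2 → ℤ)} (e : (Fin 2 → ℤ) ≃ₗ[ℤ] (Fin 2 → ℤ))
    (b : Fin 2 → ℤ) (h : IsNormal (affineMap e b ⁻¹' S)) : IsNormal S := by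
  obtain ⟨e', b', h⟩ := h
  have hs : Function.Surjective (affineMap e b) := fun y =>
    ⟨e.symm (y - b), by simp [affineMap]⟩
  refine ⟨e'.trans e, b + e b', ?_⟩
  rw [← Set.image_preimage_eq S hs, h, Set.image_image]
  refine Set.image_congr fun x _ => ?_
  simp [affineMap, add_assoc]

/-! ### Configurations with p = (-1,0) and q = (1,0) -/

section Standard

variable {S : Set (Fin 2 → ℤ)}

theorem preimage_shear (h : LatticeConfiguration S ![-1, 0] ![1, 0]) (a : ℤ) :
    LatticeConfiguration (affineMap (shear a) 0 ⁻¹' S) ![-1, 0] ![1, 0] :=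
  preimage _ _ (by simpa [affineMap_shear] using h)

theorem preimage_flipY (h : LatticeConfiguration S ![-1, 0] ![1, 0]) :
    LatticeConfiguration (affineMap flipY 0 ⁻¹' S) ![-1, 0] ![1, 0] :=
  preimage _ _ (by simpa [affineMap_flipY] using h)

theorem preimage_flipX (h : LatticeConfiguration S ![-1, 0] ![1, 0]) :
    LatticeConfiguration (affineMap flipX 0 ⁻¹' S) ![-1, 0] ![1, 0] :=
  preimage _ _ (by simpa [affineMap_flipX] using h.swap)

theorem combination_mem {p q : Fin 2 → ℤ} (h : LatticeConfiguration S p q)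
    {a b c d e f : ℤ} (ha : ![a, b] ∈ S) (hb : ![c, d] ∈ S) (hc : ![e, f] ∈ S)
    (i j k : ℤ) (hi : 0 ≤ i) (hj : 0 ≤ j) (hk : 0 ≤ k) (hn : 0 < i + j + k) {x y : ℤ}
    (hx : (i + j + k) * x = i * a + j * c + k * e)
    (hy : (i + j + k) * y = i * b + j * d + k * f) : ![x, y] ∈ S := by
  refine h.convex _ ha _ hb _ hc i j k hi hj hk hn _ ?_
  ext t; fin_cases t
  · simpa using hx
  · simpa using hy

theorem not_collinear {p q : Fin 2 → ℤ} (h : LatticeConfiguration S p q) {a b c d : ℤ}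
    (h0 : ![a, b] ∈ S) (h1 : ![a + c, b + d] ∈ S) (h2 : ![a + 2 * c, b + 2 * d] ∈ S)
    (h3 : ![a + 3 * c, b + 3 * d] ∈ S) : c = 0 ∧ d = 0 := by
  have := h.diam ![a, b] ![c, d] h0 (by simpa using h1) (by simpa using h2) (by simpa using h3)
  exact ⟨by simpa using congrFun this 0, by simpa using congrFun this 1⟩

theorem origin_mem (h : LatticeConfiguration S ![-1, 0] ![1, 0]) : ![0, 0] ∈ S :=
  h.combination_mem h.left_mem h.right_mem h.right_mem 1 1 0 (by simp) (by simp) (by simp)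
    (by simp) (by simp) (by simp)

theorem axis_bound (h : LatticeConfiguration S ![-1, 0] ![1, 0]) {x : ℤ} (hx : ![x, 0] ∈ S) :
    -1 ≤ x ∧ x ≤ 1 := by
  constructor
  · by_contra! hlt
    have h2 : ![-2, 0] ∈ S := h.combination_mem h.right_mem hx hx (-x - 2) 3 0 (by linarith)
      (by simp) (by simp) (by linarith) (by ring) (by ring)
    have := h.not_collinear (c := 1) (d := 0) h2 (by simpa using h.left_mem)
      (by simpa using h.origin_mem) (by simpa using h.right_mem)
    simp at this
  · by_contra! hlt
    have h2 : ![2, 0] ∈ S := h.combination_mem h.left_mem hx hx (x - 2) 3 0 (by linarith)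
      (by simp) (by simp) (by linarith) (by ring) (by ring)
    have := h.not_collinear (c := 1) (d := 0) h.left_mem (by simpa using h.origin_mem)
      (by simpa using h.right_mem) (by simpa using h2)
    simp at this

/-- If a < b, the segment from (-1,0) to (b,1) crosses the one from (1,0) to (a,1), at height 2 / (b
- a + 2). Applied both ways, this leaves at most one point in the row. -/
theorem row_one_le (h : LatticeConfiguration S ![-1, 0] ![1, 0]) {a b : ℤ}
    (ha : ![a, 1] ∈ S) (hb : ![b, 1] ∈ S) : b ≤ a := by
  by_contra! hlt
  have ne : ∀ x y : ℤ, ![x, 1] ≠ ![y, 0] := fun x y hxy => by simpa using congrFun hxy 1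
  refine h.cross _ hb _ ha (ne _ _) (ne _ _) (ne _ _) (ne _ _) 2 2 (b - a + 2) (by simp)
    (by linarith) (by simp) (by linarith) ?_
  ext t; fin_cases t
  · simp; ring
  · simp

/-- The bounds on `a` describe the slice at height 1 of the triangle (-1,0), (1,0), (x,y); the slice
has length 2(y - 1)/y. -/
theorem row_one_mem (h : LatticeConfiguration S ![-1, 0] ![1, 0]) {x y a : ℤ}
    (hr : ![x, y] ∈ S) (hy : 1 ≤ y) (h1 : x + 1 - y ≤ y * a) (h2 : y * a ≤ x - 1 + y) :
    ![a, 1] ∈ S :=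
  h.combination_mem h.left_mem h.right_mem hr (y - 1 - y * a + x) (y - 1 + y * a - x) 2
    (by linarith) (by linarith) (by simp) (by linarith) (by ring) (by ring)

theorem exists_row_one (h : LatticeConfiguration S ![-1, 0] ![1, 0]) {x y : ℤ}
    (hr : ![x, y] ∈ S) (hy : 1 ≤ y) : ∃ a, ![a, 1] ∈ S := by
  rcases hy.eq_or_lt with rfl | hy'
  · exact ⟨x, hr⟩
  -- For y ≥ 2 the slice has length at least 1, so the floor of its right end lies in it.
  · refine ⟨(x + y - 1) / y, h.row_one_mem hr hy ?_ ?_⟩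
    · have := Int.lt_mul_ediv_self_add (x := x + y - 1) (k := y) (by linarith)
      linarith
    · have := Int.mul_ediv_self_le (x := x + y - 1) (k := y) (by linarith)
      linarith

/-- A point with x ≥ 1 and y ≥ 2 would push the right end (x + y - 1)/y of the slice to at least 1,
putting a second lattice point in row one. -/
theorem upper_abscissa (h : LatticeConfiguration S ![-1, 0] ![1, 0]) (h1 : ![0, 1] ∈ S) {x y : ℤ}
    (hr : ![x, y] ∈ S) (hy : 1 ≤ y) : x ≤ 0 := by
  by_contra! hx
  rcases hy.eq_or_lt with rfl | hy'
  · linarith [h.row_one_le h1 hr]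
  · have l1 := Int.lt_mul_ediv_self_add (x := x + y - 1) (k := y) (by linarith)
    have l2 := Int.mul_ediv_self_le (x := x + y - 1) (k := y) (by linarith)
    have hm := h.row_one_mem (a := (x + y - 1) / y) hr hy (by linarith) (by linarith)
    have hle := h.row_one_le h1 hm
    have : y * ((x + y - 1) / y) ≤ 0 := mul_nonpos_of_nonneg_of_nonpos (by linarith) hle
    linarith

theorem upper_points_of_zero (h : LatticeConfiguration S ![-1, 0] ![1, 0]) (h1 : ![0, 1] ∈ S)
    {x y : ℤ} (hr : ![x, y] ∈ S) (hy : 1 ≤ y) : x = 0 ∧ (y = 1 ∨ y = 2) := by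
  have hx : x = 0 := by
    refine le_antisymm (h.upper_abscissa h1 hr hy) ?_
    have := h.preimage_flipX.upper_abscissa (x := -x) (y := y)
      (by simpa [affineMap_flipX] using h1) (by simpa [affineMap_flipX] using hr) hy
    linarith
  subst hx
  refine ⟨rfl, ?_⟩
  by_contra! hy3
  have hy3 : 3 ≤ y := by omega
  have mem : ∀ t : ℤ, 0 ≤ t → t ≤ y → ![0, t] ∈ S := fun t h0 ht =>
    h.combination_mem h.origin_mem hr hr (y - t) t 0 (by linarith) h0 le_rfl (by linarith)
      (by ring) (by ring)
  have := h.not_collinear (c := 0) (d := 1) h.origin_mem (by simpa using h1)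
    (by simpa using mem 2 (by simp) (by linarith)) (by simpa using mem 3 (by simp) hy3)
  simp at this

theorem upper_points (h : LatticeConfiguration S ![-1, 0] ![1, 0]) {a : ℤ} (h1 : ![a, 1] ∈ S)
    {x y : ℤ} (hr : ![x, y] ∈ S) (hy : 1 ≤ y) : (x = a ∧ y = 1) ∨ (x = 2 * a ∧ y = 2) := by
  obtain ⟨hx, hy'⟩ := (h.preimage_shear a).upper_points_of_zero (x := x - a * y) (y := y)
    (by simpa [affineMap_shear] using h1) (by simpa [affineMap_shear] using hr) hy
  rcases hy' with rfl | rfl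
  · left; exact ⟨by linarith, rfl⟩
  · right; exact ⟨by linarith, rfl⟩

theorem lower_points (h : LatticeConfiguration S ![-1, 0] ![1, 0]) {a : ℤ} (h1 : ![a, -1] ∈ S)
    {x y : ℤ} (hr : ![x, y] ∈ S) (hy : y ≤ -1) : (x = a ∧ y = -1) ∨ (x = 2 * a ∧ y = -2) := by
  have := h.preimage_flipY.upper_points (a := a) (x := x) (y := -y)
    (by simpa [affineMap_flipY] using h1) (by simpa [affineMap_flipY] using hr) (by linarith)
  omega

theorem exists_row_neg_one (h : LatticeConfiguration S ![-1, 0] ![1, 0]) {x y : ℤ}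
    (hr : ![x, y] ∈ S) (hy : y ≤ -1) : ∃ a, ![a, -1] ∈ S := by
  obtain ⟨a, ha⟩ := h.preimage_flipY.exists_row_one (x := x) (y := -y)
    (by simpa [affineMap_flipY] using hr) (by linarith)
  exact ⟨a, by simpa [affineMap_flipY] using ha⟩

theorem hidden_coordinates {p q : Fin 2 → ℤ} (h : LatticeConfiguration S p q) {a b : ℤ}
    (ha : ![a, b] ∈ S) :
    ∃ k c d : ℤ, 2 ≤ k ∧ (c ≠ 0 ∨ d ≠ 0) ∧ ![a + k * c, b + k * d] ∈ S := by
  obtain ⟨k, v, hk, hv, hm⟩ := h.hidden _ ha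
  refine ⟨k, v 0, v 1, hk, ?_, ?_⟩
  · by_contra! hz
    exact hv (by ext t; fin_cases t; exacts [hz.1, hz.2])
  · convert hm using 1
    ext t; fin_cases t <;> simp

/-- Lets `omega` use invisibility with `k * c` and `k * d` as atoms: no integer combination of the
two coordinate differences equals 1. -/
theorem mul_ne_one_of_two_le {k : ℤ} (hk : 2 ≤ k) (m : ℤ) : k * m ≠ 1 := by
  intro hm
  have := Int.eq_one_or_neg_one_of_mul_eq_one hm
  omega

theorem eq_normalPoints (h : LatticeConfiguration S ![-1, 0] ![1, 0]) (h1 : ![0, 1] ∈ S)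
    (h2 : ![0, 2] ∈ S) {b : ℤ} (hb : ![b, -1] ∈ S) (hpos : 1 ≤ b) : S = normalPoints := by
  have hb3 : b < 3 := by
    by_contra! hge
    -- The segment from (0,2) to (b,-1) meets the axis at (2b/3, 0), which is (2,0) or beyond.
    have : ![2, 0] ∈ S := h.combination_mem h.left_mem h2 hb (2 * b - 6) 3 6 (by linarith)
      (by simp) (by simp) (by linarith) (by ring) (by ring)
    have := h.axis_bound this
    omega
  have cases : ∀ x y : ℤ, ![x, y] ∈ S → (y = 0 ∧ -1 ≤ x ∧ x ≤ 1) ∨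
      (x = 0 ∧ (y = 1 ∨ y = 2)) ∨ (x = b ∧ y = -1) ∨ (x = 2 * b ∧ y = -2) := by
    intro x y hxy
    rcases lt_trichotomy y 0 with hy | rfl | hy
    · right; right; exact h.lower_points hb hxy (by omega)
    · left; exact ⟨rfl, h.axis_bound hxy⟩
    · right; left; exact h.upper_points_of_zero h1 hxy (by omega)
  obtain rfl | rfl : b = 1 ∨ b = 2 := by omega
  · exfalso
    obtain ⟨k, c, d, hk, hcd, hm⟩ := h.hidden_coordinates h1
    have n1 := mul_ne_one_of_two_le hk
    -- With b = 1 the point (0,1) sees everything: `e1` rules out (0,2), `e2` the axis, `e3` the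
    -- point (2,-2) and `e4` the point (1,-1).
    have e1 := n1 d
    have e2 := n1 (-d)
    have e3 := n1 (-(c + d))
    have e4 := n1 c
    have hk0 : k ≠ 0 := by omega
    have z : k * c ≠ 0 ∨ k * d ≠ 0 := hcd.imp (mul_ne_zero hk0) (mul_ne_zero hk0)
    simp only [mul_neg, mul_add] at e2 e3
    rcases cases _ _ hm with hc | hc | hc | hc <;> omega
  · have no : ![4, -2] ∉ S := fun h4 => by
      have : ![2, 0] ∈ S := h.combination_mem h2 h4 h4 1 1 0 (by simp) (by simp) (by simp)
        (by simp) (by simp) (by simp)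
      have := h.axis_bound this
      omega
    ext v
    obtain ⟨x, y, rfl⟩ : ∃ x y, v = ![x, y] := ⟨v 0, v 1, by ext t; fin_cases t <;> rfl⟩
    constructor
    · intro hv
      simp only [normalPoints, Set.mem_insert_iff, Set.mem_singleton_iff]
      rcases cases x y hv with ⟨rfl, hx, hx'⟩ | ⟨rfl, rfl | rfl⟩ | ⟨rfl, rfl⟩ | ⟨rfl, rfl⟩
      · interval_cases x <;> simp
      · simp
      · simp
      · simp
      · exact absurd hv no
    · rintro (hv | hv | hv | hv | hv | hv) <;> rw [hv]
      exacts [h.left_mem, h.origin_mem, h.right_mem, h1, h2, hb]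

theorem isNormal_of_two (h : LatticeConfiguration S ![-1, 0] ![1, 0]) (h1 : ![0, 1] ∈ S)
    (h2 : ![0, 2] ∈ S) : IsNormal S := by
  -- The points on the axis and (0,2) differ from (0,1) by one in height, so a point hidden from
  -- (0,1) lies below the axis.
  have lower : ∃ x y : ℤ, ![x, y] ∈ S ∧ y ≤ -1 := by
    by_contra! hno
    obtain ⟨k, c, d, hk, hcd, hm⟩ := h.hidden_coordinates h1
    have n1 := mul_ne_one_of_two_le hk
    have e1 := n1 d
    have e2 := n1 (-d)
    have hk0 : k ≠ 0 := by omega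
    have z : k * c ≠ 0 ∨ k * d ≠ 0 := hcd.imp (mul_ne_zero hk0) (mul_ne_zero hk0)
    simp only [mul_neg] at e2
    have := hno _ _ hm
    have hy : 1 ≤ 1 + k * d := by omega
    have := h.upper_points_of_zero h1 hm hy
    omega
  obtain ⟨x, y, hr, hy⟩ := lower
  obtain ⟨b, hb⟩ := h.exists_row_neg_one hr hy
  rcases lt_trichotomy b 0 with hneg | rfl | hpos
  · refine IsNormal.of_preimage flipX 0 ⟨LinearEquiv.refl ℤ _, 0, ?_⟩
    rw [h.preimage_flipX.eq_normalPoints (b := -b) (by simpa [affineMap_flipX] using h1)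
      (by simpa [affineMap_flipX] using h2) (by simpa [affineMap_flipX] using hb) (by omega)]
    simp [affineMap_refl]
  · have := h.not_collinear (c := 0) (d := 1) hb (by simpa using h.origin_mem)
      (by simpa using h1) (by simpa using h2)
    simp at this
  · refine ⟨LinearEquiv.refl ℤ _, 0, ?_⟩
    rw [h.eq_normalPoints h1 h2 hb (by omega)]
    simp [affineMap_refl]

theorem isNormal_of_upper (h : LatticeConfiguration S ![-1, 0] ![1, 0]) {x y : ℤ}
    (hr : ![x, y] ∈ S) (hy : 2 ≤ y) : IsNormal S := by
  obtain ⟨a, ha⟩ := h.exists_row_one hr (by linarith)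
  refine IsNormal.of_preimage (shear a) 0 ((h.preimage_shear a).isNormal_of_two ?_ ?_)
  · simpa [affineMap_shear] using ha
  · rcases h.upper_points ha hr (by linarith) with ⟨-, rfl⟩ | ⟨rfl, rfl⟩
    · norm_num at hy
    · simpa [affineMap_shear, mul_comm] using hr

/-- The origin sees all axis points of S, so a point hidden from it has height a nonzero multiple of
some k ≥ 2. -/
theorem isNormal_standard (h : LatticeConfiguration S ![-1, 0] ![1, 0]) : IsNormal S := by
  obtain ⟨k, c, d, hk, hcd, hm⟩ := h.hidden_coordinates h.origin_mem
  simp only [zero_add] at hm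
  rcases lt_trichotomy d 0 with hd | rfl | hd
  · refine IsNormal.of_preimage flipY 0 (h.preimage_flipY.isNormal_of_upper
      (x := k * c) (y := -(k * d)) (by simpa [affineMap_flipY] using hm) ?_)
    nlinarith
  · simp only [mul_zero] at hm
    have := h.axis_bound hm
    have e1 := mul_ne_one_of_two_le hk c
    have e2 := mul_ne_one_of_two_le hk (-c)
    simp only [mul_neg] at e2
    have hz : k * c = 0 := by omega
    rcases mul_eq_zero.mp hz with h0 | h0
    · omega
    · simp [h0] at hcd
  · exact h.isNormal_of_upper hm (by nlinarith)

end Standard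

/-! ### Moving an arbitrary pair to standard position -/

theorem isNormal {S : Set (Fin 2 → ℤ)} {p q : Fin 2 → ℤ} (h : LatticeConfiguration S p q) :
    IsNormal S := by
  obtain ⟨k, d, hk, hd, rfl⟩ := h.pair
  have mem : ∀ t : ℤ, 0 ≤ t → t ≤ k → p + t • d ∈ S := by
    intro t h0 ht
    refine h.convex _ h.left_mem _ h.right_mem _ h.right_mem (k - t) t 0 (by linarith) h0 le_rfl
      (by linarith) _ ?_
    module
  have hk2 : k = 2 := by
    by_contra hne
    exact hd (h.diam p d h.left_mem (by simpa using mem 1 (by simp) (by linarith))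
      (mem 2 (by simp) hk) (mem 3 (by simp) (by omega)))
  subst hk2
  have cop : IsCoprime (d 0) (d 1) := by
    rw [Int.isCoprime_iff_gcd_eq_one]
    set g : ℤ := (Int.gcd (d 0) (d 1) : ℤ) with hg
    obtain ⟨u, hu⟩ : g ∣ d 0 := Int.gcd_dvd_left ..
    obtain ⟨v, hv⟩ : g ∣ d 1 := Int.gcd_dvd_right ..
    have hdw : d = g • ![u, v] := by
      ext t; fin_cases t
      · simpa using hu
      · simpa using hv
    have hw : ![u, v] ≠ 0 := by
      rintro hw
      exact hd (by rw [hdw, hw, smul_zero])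
    have hg0 : g ≠ 0 := by
      intro h0
      exact hd (by rw [hdw, h0, zero_smul])
    have hgn : 0 ≤ g := by simp [hg]
    by_contra hg1
    have hg2 : 2 ≤ g := by omega
    -- An imprimitive d would put 2g + 1 ≥ 5 equally spaced lattice points between p and q.
    have mem' : ∀ t : ℤ, 0 ≤ t → t ≤ 2 * g → p + t • ![u, v] ∈ S := by
      intro t h0 ht
      refine h.convex _ h.left_mem _ h.right_mem _ h.right_mem (2 * g - t) t 0 (by linarith) h0
        le_rfl (by linarith) _ ?_
      rw [hdw]
      module
    exact hw (h.diam p _ h.left_mem (by simpa using mem' 1 (by simp) (by linarith))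
      (mem' 2 (by simp) (by linarith)) (mem' 3 (by simp) (by linarith)))
  obtain ⟨e, he⟩ := exists_affineMap_basis d cop
  have h1 : affineMap e (p + d) ![-1, 0] = p := by
    have : (![-1, 0] : Fin 2 → ℤ) = -![1, 0] := by simp
    rw [affineMap, this, map_neg, he]; abel
  have h2 : affineMap e (p + d) ![1, 0] = p + (2 : ℤ) • d := by
    rw [affineMap, he]; module
  exact IsNormal.of_preimage e (p + d)
    (isNormal_standard (preimage e (p + d) (by rw [h1, h2]; exact h)))

end LatticeConfiguration

/-! ### From real polygons to integral data -/

theorem toPlane_injective : Function.Injective toPlane := fun p q h => by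
  ext i
  exact Int.cast_injective (congrFun h i : (p i : ℝ) = q i)

theorem visible_self (p : Fin 2 → ℤ) : Visible p p := fun r hr => by
  rw [segment_same, Set.mem_singleton_iff] at hr
  exact Or.inl (toPlane_injective hr)

/-- The Bézout functional sends r - p to the parameter of r on the segment, so that parameter is an
integer in [0,1]. -/
theorem visible_of_isCoprime {p q : Fin 2 → ℤ} (h : IsCoprime (q 0 - p 0) (q 1 - p 1)) :
    Visible p q := by
  intro r hr
  rw [segment_eq_image_lineMap] at hr
  obtain ⟨t, ⟨ht0, ht1⟩, hr⟩ := hr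
  obtain ⟨a, b, hab⟩ := h
  have c : ∀ i, (r i : ℝ) = p i + t * (q i - p i) := fun i => by
    have := congrFun hr i
    simp only [AffineMap.lineMap_apply, toPlane, vsub_eq_sub, vadd_eq_add, Pi.add_apply,
      Pi.smul_apply, Pi.sub_apply, smul_eq_mul] at this
    linarith
  have hab' : (a : ℝ) * (q 0 - p 0) + b * (q 1 - p 1) = 1 := by exact_mod_cast hab
  have ht : ((a * (r 0 - p 0) + b * (r 1 - p 1) : ℤ) : ℝ) = t := by
    push_cast
    rw [c 0, c 1]
    linear_combination t * hab'
  set k := a * (r 0 - p 0) + b * (r 1 - p 1)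
  rw [← ht] at ht0 ht1 c
  have hk0 : 0 ≤ k := by exact_mod_cast ht0
  have hk1 : k ≤ 1 := by exact_mod_cast ht1
  obtain hk | hk : k = 0 ∨ k = 1 := by omega
  · left; ext i
    have := c i
    rw [hk] at this
    exact_mod_cast (by simpa using this : (r i : ℝ) = p i)
  · right; ext i
    have := c i
    rw [hk] at this
    exact_mod_cast (by simpa using this : (r i : ℝ) = q i)

theorem exists_smul_of_not_visible {p q : Fin 2 → ℤ} (h : ¬ Visible p q) :
    ∃ (k : ℤ) (d : Fin 2 → ℤ), 2 ≤ k ∧ d ≠ 0 ∧ q = p + k • d := by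
  have hne : q ≠ p := by
    rintro rfl
    exact h (visible_self _)
  have hc := mt visible_of_isCoprime h
  rw [Int.isCoprime_iff_gcd_eq_one] at hc
  set g : ℤ := (Int.gcd (q 0 - p 0) (q 1 - p 1) : ℤ) with hg
  obtain ⟨u, hu⟩ : g ∣ q 0 - p 0 := Int.gcd_dvd_left ..
  obtain ⟨v, hv⟩ : g ∣ q 1 - p 1 := Int.gcd_dvd_right ..
  have hq : q = p + g • ![u, v] := by
    ext i; fin_cases i
    · simp; linarith
    · simp; linarith
  have hg0 : g ≠ 0 := fun h0 => hne (by rw [hq, h0]; simp)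
  refine ⟨g, ![u, v], by omega, fun h0 => hne (by rw [hq, h0]; simp), hq⟩

theorem IsPolygon.eq_convexHull {P : Set (Fin 2 → ℝ)} (h : IsPolygon P) :
    P = convexHull ℝ (toPlane '' latticePoints P) := by
  obtain ⟨⟨V, hV⟩, -⟩ := h
  apply Set.Subset.antisymm
  · conv_lhs => rw [hV]
    refine convexHull_mono (Set.image_mono fun v hv => ?_)
    rw [latticePoints, Set.mem_ofPred_eq, hV]
    exact subset_convexHull ℝ _ ⟨v, hv, rfl⟩
  · refine convexHull_min ?_ (hV ▸ convex_convexHull ℝ _)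
    rintro _ ⟨v, hv, rfl⟩
    exact hv

theorem IsPolygon.convex {P : Set (Fin 2 → ℝ)} (h : IsPolygon P) : Convex ℝ P := by
  rw [h.eq_convexHull]
  exact convex_convexHull ℝ _

theorem latticePoints_combination_mem {P : Set (Fin 2 → ℝ)} (hP : Convex ℝ P)
    {a b c x : Fin 2 → ℤ} (ha : a ∈ latticePoints P) (hb : b ∈ latticePoints P)
    (hc : c ∈ latticePoints P) {i j k : ℤ} (hi : 0 ≤ i) (hj : 0 ≤ j) (hk : 0 ≤ k)
    (hn : 0 < i + j + k) (hx : (i + j + k) • x = i • a + j • b + k • c) :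
    x ∈ latticePoints P := by
  have hn' : (0 : ℝ) < i + j + k := by exact_mod_cast hn
  have hi' : (0 : ℝ) ≤ i := by exact_mod_cast hi
  have hj' : (0 : ℝ) ≤ j := by exact_mod_cast hj
  have hk' : (0 : ℝ) ≤ k := by exact_mod_cast hk
  have := hP.sum_mem (t := Finset.univ)
    (w := ![i / (i + j + k : ℝ), j / (i + j + k : ℝ), k / (i + j + k : ℝ)])
    (z := ![toPlane a, toPlane b, toPlane c])
    (by intro t _; fin_cases t <;> simp <;> positivity)
    (by simp only [Fin.sum_univ_three]; simp; field_simp)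
    (by intro t _; fin_cases t <;> assumption)
  rw [Fin.sum_univ_three] at this
  rw [latticePoints, Set.mem_ofPred_eq]
  convert this using 1
  ext t
  have ht := congrFun hx t
  simp only [Pi.smul_apply, Pi.add_apply, smul_eq_mul] at ht
  have ht' : ((i + j + k : ℝ)) * x t = i * a t + j * b t + k * c t := by exact_mod_cast ht
  simp [toPlane]
  field_simp
  linarith

theorem eq_zero_of_latticeDiameter_le {P : Set (Fin 2 → ℝ)} (hd : latticeDiameter P ≤ 2)
    {a v : Fin 2 → ℤ} (h : ∀ t : ℤ, 0 ≤ t → t ≤ 3 → a + t • v ∈ latticePoints P) : v = 0 := by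
  by_contra hv
  have inj : Function.Injective fun t : ℤ => a + t • v := fun s t hst =>
    smul_left_injective ℤ hv (add_left_cancel hst)
  have h3 : ((3 : ℕ) : ℕ∞) ≤ latticeDiameter P := by
    refine le_sSup ⟨3, (Finset.Icc (0 : ℤ) 3).map ⟨_, inj⟩, rfl, by simp, ?_, ?_⟩
    · intro x hx
      simp only [Finset.coe_map, Function.Embedding.coeFn_mk, Finset.coe_Icc] at hx
      obtain ⟨t, ht, rfl⟩ := hx
      exact h t ht.1 ht.2
    · rw [collinear_iff_exists_forall_eq_smul_vadd]
      refine ⟨toPlane a, toPlane v, ?_⟩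
      simp only [Finset.coe_map, Function.Embedding.coeFn_mk, Finset.coe_Icc]
      rintro _ ⟨_, ⟨t, _, rfl⟩, rfl⟩
      refine ⟨t, ?_⟩
      ext i
      simp [toPlane, add_comm]
  have := h3.trans hd
  exact absurd this (by decide)

theorem combination_mem_openSegment (p r : Fin 2 → ℤ) {i n : ℤ} (hi : 0 < i) (hin : i < n)
    {x : Fin 2 → ℤ} (hx : x = (n - i) • p + i • r) :
    (n : ℝ)⁻¹ • toPlane x ∈ openSegment ℝ (toPlane p) (toPlane r) := by
  have hi' : (0 : ℝ) < i := by exact_mod_cast hi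
  have hin' : (i : ℝ) < n := by exact_mod_cast hin
  have hn' : (0 : ℝ) < n := hi'.trans hin'
  refine ⟨(n - i) / n, i / n, div_pos (by linarith) hn', div_pos hi' hn', by field_simp; ring, ?_⟩
  ext t
  simp [hx, toPlane]
  field_simp

theorem IsDiploptigon.exists_latticeConfiguration {P : Set (Fin 2 → ℝ)} (hP : IsDiploptigon P)
    (hd : latticeDiameter P ≤ 2) : ∃ p q, LatticeConfiguration (latticePoints P) p q := by
  obtain ⟨poly, npan, p, q, hp, hq, hpq, vis, -, disj⟩ := hP
  have hid : ∀ a ∈ latticePoints P, ∃ b ∈ latticePoints P, ¬ Visible a b := by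
    intro a ha
    by_contra! hall
    exact npan ⟨poly, a, ha, hall⟩
  refine ⟨p, q, ?_, hp, hq, ?_, ?_, ?_, ?_⟩
  · intro a ha b hb c hc i j k hi hj hk hn x hx
    exact latticePoints_combination_mem poly.convex ha hb hc hi hj hk hn hx
  · intro a v h0 h1 h2 h3
    refine eq_zero_of_latticeDiameter_le hd (a := a) fun t ht ht' => ?_
    interval_cases t
    · simpa using h0
    · simpa using h1
    · exact h2
    · exact h3
  · intro r hr s hs h1 h2 h3 h4 i j n hi hin hj hjn heq
    exact Set.disjoint_left.mp (disj r hr s hs h1 h2 h3 h4)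
      (combination_mem_openSegment p r hi hin rfl)
      (combination_mem_openSegment q s hj hjn heq)
  · intro a ha
    obtain ⟨b, hb, hv⟩ := hid a ha
    obtain ⟨k, d, hk, hd', rfl⟩ := exists_smul_of_not_visible hv
    exact ⟨k, d, hk, hd', hb⟩
  · obtain ⟨b, hb, hv⟩ := hid p hp
    have : b = q := by
      by_contra hne
      exact hv (vis b hb hne)
    exact exists_smul_of_not_visible (this ▸ hv)

/-! ### From lattice maps back to equivalence of polygons -/

theorem toPlane_affineMap (e : (Fin 2 → ℤ) ≃ₗ[ℤ] (Fin 2 → ℤ)) (b x : Fin 2 → ℤ) :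
    toPlane (LatticeConfiguration.affineMap e b x) =
      Matrix.mulVec ((LinearMap.toMatrix' (e : (Fin 2 → ℤ) →ₗ[ℤ] (Fin 2 → ℤ))).map
        (fun a : ℤ => (a : ℝ))) (toPlane x) + toPlane b := by
  have he : e x = Matrix.mulVec (LinearMap.toMatrix' (e : (Fin 2 → ℤ) →ₗ[ℤ] (Fin 2 → ℤ))) x :=
    (LinearMap.toMatrix'_mulVec (e : (Fin 2 → ℤ) →ₗ[ℤ] (Fin 2 → ℤ)) x).symm
  rw [LatticeConfiguration.affineMap, he]
  generalize LinearMap.toMatrix' (e : (Fin 2 → ℤ) →ₗ[ℤ] (Fin 2 → ℤ)) = A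
  ext i
  fin_cases i <;> simp [toPlane, add_comm]

theorem unimodularEquivalent_of_latticePoints {P Q : Set (Fin 2 → ℝ)} (hP : IsPolygon P)
    (hQ : IsPolygon Q) (e : (Fin 2 → ℤ) ≃ₗ[ℤ] (Fin 2 → ℤ)) (b : Fin 2 → ℤ)
    (h : latticePoints P = LatticeConfiguration.affineMap e b '' latticePoints Q) :
    UnimodularEquivalent P Q := by
  set A := LinearMap.toMatrix' (e : (Fin 2 → ℤ) →ₗ[ℤ] (Fin 2 → ℤ)) with hA
  let t : (Fin 2 → ℝ) →ᵃ[ℝ] (Fin 2 → ℝ) :=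
    (Matrix.toLin' (A.map (fun a : ℤ => (a : ℝ)))).toAffineMap +
      AffineMap.const ℝ (Fin 2 → ℝ) (toPlane b)
  have ht : ∀ x, t x = Matrix.mulVec (A.map (fun a : ℤ => (a : ℝ))) x + toPlane b := fun x => by
    simp [t]
  refine ⟨t, ⟨A, b, ?_, ht⟩, ?_⟩
  · rw [← Int.isUnit_iff, hA, LinearMap.det_toMatrix']
    exact e.isUnit_det'
  · rw [hP.eq_convexHull, h]
    conv_lhs => rw [hQ.eq_convexHull]
    rw [AffineMap.image_convexHull, Set.image_image, Set.image_image]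
    congr 1
    refine Set.image_congr fun x _ => ?_
    rw [ht, toPlane_affineMap]

/-! ### The triangle is a diploptigon of lattice diameter at most 2 -/

/-- The lattice points of `diploTriangle`. -/
def diploPoints : Finset (Fin 2 → ℤ) :=
  {![1, 0], ![3, 1], ![0, 3], ![1, 1], ![2, 1], ![1, 2]}

/-- The three linear forms are 7 times the barycentric coordinates. -/
theorem mem_diploTriangle_iff (x : Fin 2 → ℝ) :
    x ∈ diploTriangle ↔
      0 ≤ 9 - 2 * x 0 - 3 * x 1 ∧ 0 ≤ 3 * x 0 + x 1 - 3 ∧ 0 ≤ 2 * x 1 - x 0 + 1 := by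
  constructor
  · refine fun hx => convexHull_min
      (t := {x : Fin 2 → ℝ | 0 ≤ 9 - 2 * x 0 - 3 * x 1 ∧ 0 ≤ 3 * x 0 + x 1 - 3 ∧
        0 ≤ 2 * x 1 - x 0 + 1}) ?_ ?_ hx
    · rintro _ (rfl | rfl | rfl) <;> norm_num
    · rintro y ⟨y1, y2, y3⟩ z ⟨z1, z2, z3⟩ a b ha hb hab
      obtain rfl : b = 1 - a := by linarith
      have m1 := add_nonneg (mul_nonneg ha y1) (mul_nonneg hb z1)
      have m2 := add_nonneg (mul_nonneg ha y2) (mul_nonneg hb z2)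
      have m3 := add_nonneg (mul_nonneg ha y3) (mul_nonneg hb z3)
      simp only [Set.mem_ofPred_eq, Pi.add_apply, Pi.smul_apply, smul_eq_mul]
      exact ⟨by linarith, by linarith, by linarith⟩
  · rintro ⟨h1, h2, h3⟩
    have := (convex_convexHull ℝ ({![1, 0], ![3, 1], ![0, 3]} : Set (Fin 2 → ℝ))).sum_mem
      (t := Finset.univ)
      (w := ![(9 - 2 * x 0 - 3 * x 1) / 7, (3 * x 0 + x 1 - 3) / 7, (2 * x 1 - x 0 + 1) / 7])
      (z := ![![1, 0], ![3, 1], ![0, 3]])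
      (by intro t _; fin_cases t <;> simp <;> linarith)
      (by rw [Fin.sum_univ_three]; simp; ring)
      (by intro t _; apply subset_convexHull; fin_cases t <;> simp)
    rw [Fin.sum_univ_three] at this
    rw [diploTriangle]
    convert this using 1
    ext t
    fin_cases t <;> simp <;> ring

theorem mem_latticePoints_diploTriangle_iff (v : Fin 2 → ℤ) :
    v ∈ latticePoints diploTriangle ↔
      0 ≤ 9 - 2 * v 0 - 3 * v 1 ∧ 0 ≤ 3 * v 0 + v 1 - 3 ∧ 0 ≤ 2 * v 1 - v 0 + 1 := by
  rw [latticePoints, Set.mem_ofPred_eq, mem_diploTriangle_iff]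
  simp only [toPlane]
  norm_cast

theorem latticePoints_diploTriangle : latticePoints diploTriangle = diploPoints := by
  ext v
  obtain ⟨x, y, rfl⟩ : ∃ x y, v = ![x, y] := ⟨v 0, v 1, by ext t; fin_cases t <;> rfl⟩
  rw [mem_latticePoints_diploTriangle_iff]
  simp only [Matrix.cons_val_zero, Matrix.cons_val_one, diploPoints, Finset.coe_insert,
    Finset.coe_singleton, Set.mem_insert_iff, Set.mem_singleton_iff, Matrix.vecCons_inj,
    and_true]
  omega

theorem isPolygon_diploTriangle : IsPolygon diploTriangle := by
  refine ⟨⟨{![1, 0], ![3, 1], ![0, 3]}, ?_⟩, ?_⟩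
  · have e : ∀ a b : ℤ, toPlane ![a, b] = ![(a : ℝ), (b : ℝ)] := fun a b => by
      ext t; fin_cases t <;> rfl
    simp [diploTriangle, Set.image_insert_eq, e]
  · rw [diploTriangle, affineSpan_convexHull, eq_top_iff]
    set A := affineSpan ℝ ({![1, 0], ![3, 1], ![0, 3]} : Set (Fin 2 → ℝ))
    have m0 : ![1, 0] ∈ A := subset_affineSpan ℝ _ (by simp)
    have m1 : ![3, 1] ∈ A := subset_affineSpan ℝ _ (by simp)
    have m2 : ![0, 3] ∈ A := subset_affineSpan ℝ _ (by simp)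
    intro x _
    have := AffineSubspace.vadd_mem_of_mem_direction (add_mem
      (A.direction.smul_mem ((3 * x 0 + x 1 - 3) / 7) (AffineSubspace.vsub_mem_direction m1 m0))
      (A.direction.smul_mem ((2 * x 1 - x 0 + 1) / 7) (AffineSubspace.vsub_mem_direction m2 m0))) m0
    convert this using 1
    ext t
    fin_cases t <;> simp <;> ring

theorem not_visible_of_midpoint {p q r : Fin 2 → ℤ} (h : r + r = p + q) (hne : p ≠ q) :
    ¬ Visible p q := by
  intro hv
  have hr : toPlane r ∈ segment ℝ (toPlane p) (toPlane q) := by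
    refine ⟨1 / 2, 1 / 2, by norm_num, by norm_num, by norm_num, ?_⟩
    ext t
    have : (r t : ℝ) + r t = p t + q t := by exact_mod_cast congrFun h t
    simp [toPlane]
    linarith
  rcases hv r hr with rfl | rfl
  · exact hne (add_left_cancel h)
  · exact hne (add_right_cancel h).symm

theorem not_isPanoptigon_diploTriangle : ¬ IsPanoptigon diploTriangle := by
  rintro ⟨-, p, hp, hall⟩
  rw [latticePoints_diploTriangle] at hp hall
  -- Each lattice point of the triangle agrees mod 2 with another one, and their midpoint blocks the
  -- view.
  have key : ∀ p ∈ diploPoints, ∃ q ∈ diploPoints, ∃ r ∈ diploPoints, r + r = p + q ∧ p ≠ q := by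
    decide +kernel
  obtain ⟨q, hq, r, -, hr, hne⟩ := key p hp
  exact not_visible_of_midpoint hr hne (hall q hq)

theorem isDiploptigonPair_diploTriangle : IsDiploptigonPair diploTriangle ![1, 1] ![3, 1] := by
  have vis : ∀ p r : Fin 2 → ℤ, p = r ∨ Int.gcd (r 0 - p 0) (r 1 - p 1) = 1 → Visible p r := by
    rintro p r (rfl | h)
    · exact visible_self p
    · exact visible_of_isCoprime (Int.isCoprime_iff_gcd_eq_one.mpr h)
  rw [IsDiploptigonPair, latticePoints_diploTriangle]
  refine ⟨by decide +kernel, by decide +kernel, by decide +kernel, fun r hr hne => vis _ _ ?_,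
    fun r hr hne => vis _ _ ?_, ?_⟩
  · have key : ∀ r ∈ diploPoints, r ≠ ![3, 1] →
        ![1, 1] = r ∨ Int.gcd (r 0 - ![1, 1] 0) (r 1 - ![1, 1] 1) = 1 := by decide +kernel
    exact key r hr hne
  · have key : ∀ r ∈ diploPoints, r ≠ ![1, 1] →
        ![3, 1] = r ∨ Int.gcd (r 0 - ![3, 1] 0) (r 1 - ![3, 1] 1) = 1 := by decide +kernel
    exact key r hr hne
  · have key : ∀ r ∈ diploPoints, r ≠ ![1, 1] → r ≠ ![3, 1] →
        r = ![1, 0] ∨ r = ![0, 3] ∨ r = ![2, 1] ∨ r = ![1, 2] := by decide +kernel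
    intro r hr s hs h1 h2 h3 h4
    rw [Set.disjoint_left]
    rintro z ⟨a, b, ha, hb, hab, rfl⟩ ⟨c, d, hc, hd, hcd, h⟩
    have e0 := congrFun h 0
    have e1 := congrFun h 1
    obtain rfl | rfl | rfl | rfl := key r hr h1 h2 <;>
    obtain rfl | rfl | rfl | rfl := key s hs h3 h4 <;>
    · simp [toPlane] at e0 e1
      linarith

theorem latticeDiameter_diploTriangle_le : latticeDiameter diploTriangle ≤ 2 := by
  have key : ∀ S ∈ diploPoints.powerset, (∀ a ∈ S, ∀ b ∈ S, ∀ c ∈ S,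
      (b 0 - a 0) * (c 1 - a 1) = (b 1 - a 1) * (c 0 - a 0)) → S.card ≤ 3 := by
    decide +kernel
  refine sSup_le ?_
  rintro _ ⟨d, S, rfl, hcard, hsub, hcol⟩
  rw [latticePoints_diploTriangle, Finset.coe_subset] at hsub
  have := key S (Finset.mem_powerset.mpr hsub) ?_
  · have hd : d ≤ 2 := by omega
    exact_mod_cast hd
  · intro a ha b hb c hc
    rw [collinear_iff_exists_forall_eq_smul_vadd] at hcol
    obtain ⟨o, w, ho⟩ := hcol
    have co : ∀ x ∈ S, ∃ t : ℝ, ∀ i, (x i : ℝ) = t * w i + o i := fun x hx => by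
      obtain ⟨t, ht⟩ := ho _ ⟨x, hx, rfl⟩
      exact ⟨t, fun i => by simpa [toPlane] using congrFun ht i⟩
    obtain ⟨s, hs⟩ := co a ha
    obtain ⟨t, ht⟩ := co b hb
    obtain ⟨u, hu⟩ := co c hc
    have : ((b 0 - a 0) * (c 1 - a 1) : ℝ) = (b 1 - a 1) * (c 0 - a 0) := by
      rw [hs, hs, ht, ht, hu, hu]
      ring
    exact_mod_cast this

/-! ### Matching the triangle with the normal form -/

theorem normalPoints_eq_image : LatticeConfiguration.normalPoints =
    LatticeConfiguration.affineMap ((LatticeConfiguration.shear 1).trans LatticeConfiguration.flipX)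
      ![3, -1] '' latticePoints diploTriangle := by
  -- This map sends the pair (1,1), (3,1) to (1,0), (-1,0).
  have e : ∀ x y : ℤ, LatticeConfiguration.affineMap
      ((LatticeConfiguration.shear 1).trans LatticeConfiguration.flipX) ![3, -1] ![x, y] =
        ![3 - x - y, y - 1] := by
    intro x y
    have h1 := LatticeConfiguration.affineMap_shear 1 x y
    have h2 := LatticeConfiguration.affineMap_flipX (x + 1 * y) y
    simp only [LatticeConfiguration.affineMap, zero_add] at h1 h2
    rw [LatticeConfiguration.affineMap, LinearEquiv.trans_apply, h1, h2]
    ext t; fin_cases t <;> simp <;> ring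
  rw [latticePoints_diploTriangle]
  simp only [diploPoints, Finset.coe_insert, Finset.coe_singleton, Set.image_insert_eq,
    Set.image_singleton, e, LatticeConfiguration.normalPoints]
  norm_num
  ext v
  simp only [Set.mem_insert_iff, Set.mem_singleton_iff]
  tauto

theorem mainTheorem3 :
    (IsDiploptigon diploTriangle ∧ latticeDiameter diploTriangle ≤ 2) ∧
      ∀ P : Set (Fin 2 → ℝ), IsDiploptigon P → latticeDiameter P ≤ 2 →
        UnimodularEquivalent P diploTriangle := by
  refine ⟨⟨⟨isPolygon_diploTriangle, not_isPanoptigon_diploTriangle, _, _,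
    isDiploptigonPair_diploTriangle⟩, latticeDiameter_diploTriangle_le⟩, fun P hP hd => ?_⟩
  obtain ⟨p, q, h⟩ := hP.exists_latticeConfiguration hd
  obtain ⟨e, b, hS⟩ := h.isNormal
  rw [normalPoints_eq_image, Set.image_image] at hS
  refine unimodularEquivalent_of_latticePoints hP.1 isPolygon_diploTriangle
    (((LatticeConfiguration.shear 1).trans LatticeConfiguration.flipX).trans e)
    (b + e ![3, -1]) ?_
  rw [hS]
  refine Set.image_congr fun x _ => ?_
  simp only [LatticeConfiguration.affineMap, map_add, LinearEquiv.trans_apply, add_assoc]
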